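/- Let $p$ be a prime, $r\ge 1$ an integer and $q=p^r$. The Fesenko group $T=T(r)$ is \[ T=\Big\{\,t+\sum_{k\ge 1}a_{qk+1}t^{qk+1}\;:\; a_{qk+1}\in\mathbb F_p\Big\}\subset \mathbb F_p[[t]], \] with substitution of formal power series, $(u\cdot v)(t)=u(v(t))$, as group operation and with the topology of coefficientwise convergence ($\mathbb F_p$ discrete); it is a closed subgroup of the Nottingham group $\{t+\sum_{k\ge1}a_kt^{k+1}: a_k\in\mathbb F_p\}$. For a pro-$p$ group $G$ let $\gamma_n(G)$ denote the (closed) $n$-th term of its lower central series, $\gamma_1(G)=G$, and put \[ \mu_n(G)=\gamma_{n+1}(G)\cap\bigcap\{N : N \text{ a closed normal subgroup of } G,\ N\not\subseteq\gamma_{n+1}(G)\}, \] \[ o(G)=\sup_{n}\ \log_p|\gamma_{n+1}(G):\mu_n(G)|\ \in\ [0,\infty], \] where $\log_p$ of an infinite index is $\infty$. The number $o(G)$ is the obliquity of $G$. **Proposition.** The Fesenko group $T=T(r)$ has infinite obliquity: $o(T)=\infty$. -/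

import Mathlib

open scoped PowerSeries.WithPiTopology

/-! ## The Nottingham group over the field with `p` elements -/

/-- The Nottingham group: power series `u(t) = t + (terms of degree ≥ 2)` over `𝔽_p`. -/
@[ext]
structure Nottingham (p : ℕ) where
  /-- the underlying power series -/
  val : PowerSeries (ZMod p)
  coeff_zero : PowerSeries.coeff 0 val = 0
  coeff_one : PowerSeries.coeff 1 val = 1

namespace Nottingham

variable {p : ℕ}

theorem constantCoeff_val (u : Nottingham p) : PowerSeries.constantCoeff u.val = 0 := by
  rw [← PowerSeries.coeff_zero_eq_constantCoeff_apply]; exact u.coeff_zero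

theorem hasSubst (u : Nottingham p) : PowerSeries.HasSubst u.val :=
  PowerSeries.HasSubst.of_constantCoeff_zero' u.constantCoeff_val

theorem isUnit_coeff_one (u : Nottingham p) : IsUnit (PowerSeries.coeff 1 u.val) := by
  rw [u.coeff_one]; exact isUnit_one

theorem X_pow_dvd_val_pow (u : Nottingham p) (d : ℕ) :
    (PowerSeries.X : PowerSeries (ZMod p)) ^ d ∣ u.val ^ d :=
  pow_dvd_pow_of_dvd (PowerSeries.X_dvd_iff.mpr u.constantCoeff_val) d

theorem coeff_pow_of_lt (u : Nottingham p) {n d : ℕ} (h : n < d) :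
    PowerSeries.coeff n (u.val ^ d) = 0 :=
  PowerSeries.X_pow_dvd_iff.mp (u.X_pow_dvd_val_pow d) n h

theorem coeff_subst_val (f : PowerSeries (ZMod p)) (v : Nottingham p) (n : ℕ) :
    PowerSeries.coeff n (f.subst v.val) =
      ∑ d ∈ Finset.range (n + 1),
        PowerSeries.coeff d f * PowerSeries.coeff n (v.val ^ d) := by
  rw [PowerSeries.coeff_subst' v.hasSubst]
  simp only [smul_eq_mul]
  refine finsum_eq_finsetSum_of_support_subset _ fun d hd => ?_
  by_contra hn
  have hlt : n < d := by simpa using hn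
  exact hd (by simp [v.coeff_pow_of_lt hlt])

/-- The product of `u` and `v` is the series `u(v(t))`, obtained by substituting `v` into `u`. -/
noncomputable instance : Mul (Nottingham p) where
  mul u v :=
    { val := u.val.subst v.val
      coeff_zero := by
        simp [coeff_subst_val, u.constantCoeff_val]
      coeff_one := by
        simp [coeff_subst_val, Finset.sum_range_succ, u.coeff_one, v.coeff_one] }

theorem mul_val (u v : Nottingham p) : (u * v).val = u.val.subst v.val := rfl

noncomputable instance : One (Nottingham p) where
  one :=
    { val := PowerSeries.X
      coeff_zero := PowerSeries.coeff_zero_X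
      coeff_one := PowerSeries.coeff_one_X }

theorem one_val : (1 : Nottingham p).val = PowerSeries.X := rfl

/-- The inverse of `u` is the compositional inverse of the series `u`. -/
noncomputable instance : Inv (Nottingham p) where
  inv u :=
    { val := u.val.substInvOfIsUnit u.isUnit_coeff_one
      coeff_zero := by simp
      coeff_one := by
        rw [PowerSeries.coeff_one_substInvOfIsUnit]
        have h : (u.isUnit_coeff_one).unit = 1 := Units.ext u.coeff_one
        simp [h] }

noncomputable instance : Group (Nottingham p) :=
  Group.ofLeftAxioms
    (fun u v w => Nottingham.ext (PowerSeries.subst_comp_subst_apply v.hasSubst w.hasSubst u.val))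
    (fun u => Nottingham.ext (PowerSeries.subst_X u.hasSubst))
    (fun u => Nottingham.ext
      (PowerSeries.subst_substInvOfIsUnit_left u.val u.constantCoeff_val u.isUnit_coeff_one))

/-! The topology of coefficientwise convergence (each coefficient lies in the discrete
space `𝔽_p`). -/

instance : TopologicalSpace (Nottingham p) := TopologicalSpace.induced Nottingham.val inferInstance

theorem continuous_val : Continuous (Nottingham.val : Nottingham p → _) := continuous_induced_dom

/-- `u` and `v` agree up to degree `n`. -/
def Agree (n : ℕ) (u v : Nottingham p) : Prop :=
  ∀ i ≤ n, PowerSeries.coeff i u.val = PowerSeries.coeff i v.val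

theorem agree_iff {n : ℕ} {u v : Nottingham p} :
    Agree n u v ↔ (PowerSeries.X : PowerSeries (ZMod p)) ^ (n + 1) ∣ u.val - v.val := by
  rw [PowerSeries.X_pow_dvd_iff]
  simp [Agree, sub_eq_zero]

theorem Agree.symm {n : ℕ} {u v : Nottingham p} (h : Agree n u v) : Agree n v u :=
  fun i hi => (h i hi).symm

theorem Agree.mul {n : ℕ} {u u' v v' : Nottingham p} (hu : Agree n u u') (hv : Agree n v v') :
    Agree n (u * v) (u' * v') := by
  intro i hi
  rw [mul_val, mul_val, coeff_subst_val, coeff_subst_val]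
  refine Finset.sum_congr rfl fun d hd => ?_
  have hd' : d ≤ n := (Nat.lt_succ_iff.mp (Finset.mem_range.mp hd)).trans hi
  have h := (agree_iff.mp hv).trans (sub_dvd_pow_sub_pow v.val v'.val d)
  have h2 := PowerSeries.X_pow_dvd_iff.mp h i (Nat.lt_succ_iff.mpr hi)
  rw [map_sub, sub_eq_zero] at h2
  rw [hu d hd', h2]

theorem Agree.inv {n : ℕ} {u v : Nottingham p} (h : Agree n u v) : Agree n u⁻¹ v⁻¹ := by
  have h1 : Agree n (u⁻¹ * v * v⁻¹) (u⁻¹ * u * v⁻¹) :=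
    ((show Agree n u⁻¹ u⁻¹ from fun _ _ => rfl).mul h.symm).mul (fun _ _ => rfl)
  simpa using h1

theorem isOpen_agree (n : ℕ) (u : Nottingham p) : IsOpen {v : Nottingham p | Agree n v u} := by
  have : {v : Nottingham p | Agree n v u} = ⋂ i ∈ Finset.range (n + 1),
      (fun v : Nottingham p => PowerSeries.coeff i v.val) ⁻¹' {PowerSeries.coeff i u.val} := by
    ext v; simp [Agree]
  rw [this]
  exact isOpen_biInter_finset fun i _ => (isOpen_discrete _).preimage
    ((PowerSeries.WithPiTopology.continuous_coeff (ZMod p) i).comp continuous_val)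

theorem eventually_agree (n : ℕ) (u : Nottingham p) : ∀ᶠ v in nhds u, Agree n v u :=
  (isOpen_agree n u).mem_nhds (show Agree n u u from fun _ _ => rfl)

theorem continuous_of_agree {Y : Type} [TopologicalSpace Y] (f : Y → Nottingham p)
    (h : ∀ y n, ∀ᶠ z in nhds y, Agree n (f z) (f y)) : Continuous f := by
  refine continuous_induced_rng.mpr (continuous_iff_continuousAt.mpr fun y => ?_)
  refine (PowerSeries.WithPiTopology.tendsto_iff_coeff_tendsto (ZMod p) _ _ _).mpr fun n => ?_
  exact tendsto_nhds_of_eventually_eq ((h y n).mono fun z hz => hz n le_rfl)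

instance : IsTopologicalGroup (Nottingham p) where
  continuous_mul := continuous_of_agree _ fun y n => by
    rw [nhds_prod_eq]
    filter_upwards [(eventually_agree n y.1).prod_mk (eventually_agree n y.2)] with z hz
    exact hz.1.mul hz.2
  continuous_inv := continuous_of_agree _ fun y n =>
    (eventually_agree n y).mono fun _ hz => hz.inv

end Nottingham

/-! ## The Fesenko groups -/

/-- For `q = p ^ r`, the `q`-th power of a series over `𝔽_p` is a series in `t ^ q`. -/
theorem coeff_pow_pow_of_not_dvd {p : ℕ} [Fact p.Prime] (r : ℕ) (f : PowerSeries (ZMod p)) {n : ℕ}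
    (h : ¬ p ^ r ∣ n) : PowerSeries.coeff n (f ^ p ^ r) = 0 := by
  have hp : p ≠ 0 := (Fact.out : p.Prime).ne_zero
  have key : PowerSeries.map (iterateFrobenius (ZMod p) p r)
      (PowerSeries.expand (p ^ r) (pow_ne_zero r hp) f) = f ^ p ^ r :=
    MvPowerSeries.map_iterateFrobenius_expand p hp f r
  rw [← key, PowerSeries.coeff_map, PowerSeries.coeff_expand_of_not_dvd _ _ _ h, map_zero]

theorem coeff_pow_pow_pow_of_not_dvd {p : ℕ} [Fact p.Prime] (r k : ℕ) (f : PowerSeries (ZMod p))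
    {n : ℕ} (h : ¬ p ^ r ∣ n) : PowerSeries.coeff n (f ^ (p ^ r * k)) = 0 := by
  rw [mul_comm, pow_mul]
  exact coeff_pow_pow_of_not_dvd r _ h

/-- The Fesenko group `T(r)`: with `q = p ^ r`, the subgroup of the Nottingham group over `𝔽_p`
of all series `t + ∑_{k ≥ 1} a_{qk+1} t^{qk+1}`, that is, of all series in which only the
exponents of the form `qk + 1` occur. -/
noncomputable def FesenkoGroup (p r : ℕ) [Fact p.Prime] : Subgroup (Nottingham p) where
  carrier := {u | ∀ n, PowerSeries.coeff n u.val ≠ 0 → ∃ k, n = p ^ r * k + 1}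
  one_mem' := by
    intro n hn
    refine ⟨0, ?_⟩
    by_contra h
    exact hn (by rw [Nottingham.one_val, PowerSeries.coeff_X, if_neg (by simpa using h)])
  mul_mem' := by
    intro u v hu hv n hn
    rw [Nottingham.mul_val, Nottingham.coeff_subst_val] at hn
    obtain ⟨d, -, hd⟩ := Finset.exists_ne_zero_of_sum_ne_zero hn
    obtain ⟨k, rfl⟩ := hu d (left_ne_zero_of_mul hd)
    have h2 := right_ne_zero_of_mul hd
    rw [pow_succ, PowerSeries.coeff_mul] at h2
    obtain ⟨⟨i, j⟩, hij, h3⟩ := Finset.exists_ne_zero_of_sum_ne_zero h2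
    obtain ⟨m, rfl⟩ : p ^ r ∣ i := by
      by_contra hi
      exact h3 (by simp [coeff_pow_pow_pow_of_not_dvd r k v.val hi])
    obtain ⟨l, rfl⟩ := hv j (right_ne_zero_of_mul h3)
    refine ⟨m + l, ?_⟩
    rw [← Finset.HasAntidiagonal.mem_antidiagonal.mp hij]
    ring
  inv_mem' := by
    intro u hu n
    induction n using Nat.strong_induction_on with
    | _ n ih =>
      intro hn
      by_contra hk
      apply hn
      have h1 : PowerSeries.coeff n (u * u⁻¹).val = 0 := by
        rw [mul_inv_cancel, Nottingham.one_val, PowerSeries.coeff_X,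
          if_neg fun h => hk ⟨0, by simpa using h⟩]
      rw [Nottingham.mul_val, Nottingham.coeff_subst_val] at h1
      by_cases hn0 : n = 0
      · rw [hn0]; exact u⁻¹.coeff_zero
      rw [Finset.sum_eq_single 1, u.coeff_one, one_mul, pow_one] at h1
      · exact h1
      · intro d _ hd1
        by_contra h2
        obtain ⟨k, rfl⟩ := hu d (left_ne_zero_of_mul h2)
        have hk0 : k ≠ 0 := by rintro rfl; simp at hd1
        have h4 := right_ne_zero_of_mul h2
        rw [pow_succ, PowerSeries.coeff_mul] at h4
        obtain ⟨⟨i, j⟩, hij, h3⟩ := Finset.exists_ne_zero_of_sum_ne_zero h4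
        have hij' : i + j = n := Finset.HasAntidiagonal.mem_antidiagonal.mp hij
        have hi0 : i ≠ 0 := by
          rintro rfl
          refine left_ne_zero_of_mul h3 (Nottingham.coeff_pow_of_lt _ ?_)
          exact Nat.mul_pos (pow_pos (Fact.out : p.Prime).pos r) (Nat.pos_of_ne_zero hk0)
        obtain ⟨m, rfl⟩ : p ^ r ∣ i := by
          by_contra hi
          exact left_ne_zero_of_mul h3 (coeff_pow_pow_pow_of_not_dvd r k _ hi)
        obtain ⟨l, rfl⟩ := ih j (by omega) (right_ne_zero_of_mul h3)
        exact hk ⟨m + l, by rw [← hij']; ring⟩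
      · intro h
        exact absurd (Finset.mem_range.mpr (by omega)) h

/-! ## Lower central series and obliquity of a pro-`p` group -/

section Obliquity

variable (G : Type*) [Group G] [TopologicalSpace G] [IsTopologicalGroup G]

/-- The term `γ_{n+1}(G)` of the lower central series of the topological group `G`: the closure of
the abstract term. (So `n = 0` gives `γ_1(G) = G`; Mathlib's `lowerCentralSeries` starts with
index `0`.) -/
def proGammaSucc (n : ℕ) : Subgroup G :=
  ((⊤ : Subgroup G).lowerCentralSeries n).topologicalClosure

/-- `μ_n(G)`: the intersection of `γ_{n+1}(G)` with all closed normal subgroups `N` of `G` that are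
not contained in `γ_{n+1}(G)`. -/
def proMu (n : ℕ) : Subgroup G :=
  proGammaSucc G n ⊓
    sInf {N : Subgroup G | N.Normal ∧ IsClosed (N : Set G) ∧ ¬ N ≤ proGammaSucc G n}

open Classical in
/-- `log_p |H : K|`, with value `∞` if the index is infinite (`K.relIndex H = 0` means exactly
that the index of `K ⊓ H` in `H` is infinite). -/
noncomputable def logRelIndex {G : Type*} [Group G] (p : ℕ) (H K : Subgroup G) : EReal :=
  if K.relIndex H = 0 then ⊤ else ((Real.logb p (K.relIndex H) : ℝ) : EReal)

/-- The obliquity `o(G) = sup_n log_p |γ_{n+1}(G) : μ_n(G)|` of a pro-`p` group `G`. -/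
noncomputable def obliquity (p : ℕ) : EReal :=
  ⨆ n : ℕ, logRelIndex p (proGammaSucc G n) (proMu G n)

end Obliquity

/-! ## The reduced series of an element of the Fesenko group -/

namespace FesenkoGroup

open PowerSeries
open scoped commutatorElement

variable {p r : ℕ} [Fact p.Prime]

/-! Write u(t) = t F(t^q). Then composition becomes F_{uv} = F_v · (F_u ∘ x F_v^q), and every power
F^{qd} is a series in x^q, even in x^{pq} when p ∣ d. If F_v - 1 has order m, a commutator with v
therefore has order at least m + q, while exponents divisible by p are pushed up p times faster, in
steps of pq. The second effect is linear, hence visible only below 2m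
(`commutator_mem_primitiveCongruence`).

After 2k commutators the order exceeds 2kq; k further ones clear all exponents divisible by p up to
4kq, as kpq ≥ 2kq. So 1 + x^{4kq} is not in γ_{3k+1}, and μ_{3k} lies in the congruence subgroup of
order 4kq. Commutation with t + t^{q+1} multiplies a leading coefficient of order m by m, so
γ_{3k+1} has elements of order 3kq + j for every j ≥ 2 prime to p. About k of these orders lie below
4kq and give distinct cosets of μ_{3k}, so the index is unbounded. -/

theorem prime_pow_ne_zero (p r : ℕ) [Fact p.Prime] : p ^ r ≠ 0 :=
  pow_ne_zero r (Fact.out : p.Prime).ne_zero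

/-- The series `F(x)` with `u(t) = t * F(t ^ q)`. -/
noncomputable def reduced (u : FesenkoGroup p r) : PowerSeries (ZMod p) :=
  PowerSeries.mk fun k => coeff (p ^ r * k + 1) u.1.val

theorem constantCoeff_reduced (u : FesenkoGroup p r) : constantCoeff (reduced u) = 1 := by
  rw [← coeff_zero_eq_constantCoeff_apply, reduced, coeff_mk, mul_zero, zero_add, u.1.coeff_one]

theorem val_eq_X_mul_expand (u : FesenkoGroup p r) :
    u.1.val = X * expand (p ^ r) (prime_pow_ne_zero p r) (reduced u) := by
  ext n
  cases n with
  | zero => simp [u.1.constantCoeff_val]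
  | succ n =>
    rw [coeff_succ_X_mul]
    by_cases h : p ^ r ∣ n
    · obtain ⟨k, rfl⟩ := h
      rw [coeff_expand_mul, reduced, coeff_mk]
    · rw [coeff_expand_of_not_dvd _ _ _ h]
      by_contra hn
      obtain ⟨k, hk⟩ := u.2 _ hn
      exact h ⟨k, by omega⟩

theorem expand_injective {R : Type*} [CommRing R] (n : ℕ) (hn : n ≠ 0) :
    Function.Injective (expand n hn : PowerSeries R → PowerSeries R) := by
  intro f g h
  ext k
  rw [← coeff_expand_mul n hn f, h, coeff_expand_mul]

/-- The element `t * A(t ^ q)` of the Fesenko group. -/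
noncomputable def ofReduced (r : ℕ) (A : PowerSeries (ZMod p)) (hA : constantCoeff A = 1) :
    FesenkoGroup p r where
  val :=
    { val := X * expand (p ^ r) (prime_pow_ne_zero p r) A
      coeff_zero := by simp
      coeff_one := by
        rw [coeff_succ_X_mul, coeff_zero_eq_constantCoeff_apply, constantCoeff_expand, hA] }
  property := by
    intro n hn
    cases n with
    | zero => simp at hn
    | succ n =>
      rw [coeff_succ_X_mul] at hn
      by_cases h : p ^ r ∣ n
      · obtain ⟨k, rfl⟩ := h
        exact ⟨k, rfl⟩
      · exact absurd (coeff_expand_of_not_dvd _ _ _ h) hn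

theorem reduced_ofReduced (A : PowerSeries (ZMod p)) (hA : constantCoeff A = 1) :
    reduced (ofReduced r A hA) = A := by
  ext k
  rw [reduced, coeff_mk, ofReduced, coeff_succ_X_mul, coeff_expand_mul]

/-- The series `x * F(x) ^ q`, where `F` is the reduced series of `u`. -/
noncomputable def dilation (u : FesenkoGroup p r) : Nottingham p where
  val := X * reduced u ^ p ^ r
  coeff_zero := by simp
  coeff_one := by
    rw [coeff_succ_X_mul, coeff_zero_eq_constantCoeff_apply, map_pow, constantCoeff_reduced,
      one_pow]

/-- Substitution of `x * F(x) ^ q`, where `F` is the reduced series of `u`. -/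
noncomputable def act (u : FesenkoGroup p r) :
    PowerSeries (ZMod p) →ₐ[ZMod p] PowerSeries (ZMod p) :=
  substAlgHom (dilation u).hasSubst

theorem act_apply (u : FesenkoGroup p r) (f : PowerSeries (ZMod p)) :
    act u f = f.subst (dilation u).val := by
  rw [act, coe_substAlgHom]

theorem reduced_one : reduced (1 : FesenkoGroup p r) = 1 := by
  have h : X * expand (p ^ r) (prime_pow_ne_zero p r) (reduced (1 : FesenkoGroup p r)) =
      X * expand (p ^ r) (prime_pow_ne_zero p r) (1 : PowerSeries (ZMod p)) := by
    rw [← val_eq_X_mul_expand, map_one, mul_one]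
    rfl
  exact expand_injective _ _ (X_mul_cancel h)

/-- u(v(t)) = v(t) F_u(v(t)^q), and v(t)^q = x F_v(x)^q with x = t^q. -/
theorem reduced_mul (u v : FesenkoGroup p r) :
    reduced (u * v) = reduced v * act v (reduced u) := by
  have hX : HasSubst (X ^ p ^ r : PowerSeries (ZMod p)) := HasSubst.X_pow (prime_pow_ne_zero p r)
  have h1 : (u * v).1.val = v.1.val *
      (expand (p ^ r) (prime_pow_ne_zero p r) (reduced u)).subst v.1.val := by
    change u.1.val.subst v.1.val = _
    rw [val_eq_X_mul_expand u, subst_mul v.1.hasSubst, subst_X v.1.hasSubst]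
  have h2 : (expand (p ^ r) (prime_pow_ne_zero p r) (reduced u)).subst v.1.val =
      expand (p ^ r) (prime_pow_ne_zero p r) (act v (reduced u)) := by
    rw [act_apply, expand_apply, expand_apply, subst_comp_subst_apply hX v.1.hasSubst,
      subst_comp_subst_apply (dilation v).hasSubst hX, subst_pow v.1.hasSubst,
      subst_X v.1.hasSubst, ← expand_apply _ (prime_pow_ne_zero p r)]
    congr 1
    change _ = expand _ _ (X * reduced v ^ p ^ r)
    rw [map_mul, map_pow, expand_X, ← mul_pow, ← val_eq_X_mul_expand]
  apply expand_injective (p ^ r) (prime_pow_ne_zero p r)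
  apply X_mul_cancel
  rw [← val_eq_X_mul_expand, h1, h2, map_mul, ← mul_assoc, ← val_eq_X_mul_expand]

/-! ### Coefficients under the action -/

theorem coeff_reduced_pow_of_not_dvd (u : FesenkoGroup p r) {n d : ℕ} (h : ¬ p ^ r ∣ n) :
    coeff n (reduced u ^ (p ^ r * d)) = 0 :=
  coeff_pow_pow_pow_of_not_dvd r d _ h

theorem coeff_act (u : FesenkoGroup p r) (f : PowerSeries (ZMod p)) (n : ℕ) :
    coeff n (act u f) = coeff n f +
      ∑ d ∈ Finset.range n, coeff d f * coeff (n - d) (reduced u ^ (p ^ r * d)) := by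
  have h (d : ℕ) (hd : d ≤ n) : coeff n ((dilation u).val ^ d) =
      coeff (n - d) (reduced u ^ (p ^ r * d)) := by
    change coeff n ((X * reduced u ^ p ^ r) ^ d) = _
    rw [mul_pow, coeff_X_pow_mul', if_pos hd, pow_mul]
  rw [act_apply, Nottingham.coeff_subst_val, Finset.sum_range_succ, add_comm, h n le_rfl,
    Nat.sub_self, coeff_zero_eq_constantCoeff_apply, map_pow, constantCoeff_reduced, one_pow,
    mul_one]
  congr 1
  exact Finset.sum_congr rfl fun d hd => by rw [h d (Finset.mem_range.mp hd).le]

/-- A term of degree d only feeds degrees d + q, d + 2q, …, since F^{qd} is a series in x^q. -/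
theorem X_pow_dvd_act_sub (u : FesenkoGroup p r) {f : PowerSeries (ZMod p)} {m : ℕ}
    (hf : X ^ m ∣ f) : X ^ (m + p ^ r) ∣ act u f - f := by
  rw [X_pow_dvd_iff] at hf ⊢
  intro n hn
  rw [map_sub, coeff_act, add_sub_cancel_left]
  refine Finset.sum_eq_zero fun d hd => ?_
  rw [Finset.mem_range] at hd
  by_cases hdm : d < m
  · rw [hf d hdm, zero_mul]
  · rw [coeff_reduced_pow_of_not_dvd, mul_zero]
    exact Nat.not_dvd_of_pos_of_lt (by omega) (by omega)

theorem X_pow_dvd_act (u : FesenkoGroup p r) {f : PowerSeries (ZMod p)} {m : ℕ}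
    (hf : X ^ m ∣ f) : X ^ m ∣ act u f := by
  have h := dvd_add ((pow_dvd_pow X (Nat.le_add_right m (p ^ r))).trans (X_pow_dvd_act_sub u hf)) hf
  rwa [sub_add_cancel] at h

theorem X_pow_dvd_of_act (u : FesenkoGroup p r) {f : PowerSeries (ZMod p)} {m : ℕ}
    (hf : X ^ m ∣ act u f) : X ^ m ∣ f := by
  rw [X_pow_dvd_iff] at hf ⊢
  intro n
  induction n using Nat.strong_induction_on with
  | _ n ih =>
    intro hn
    have h := hf n hn
    rwa [coeff_act, Finset.sum_eq_zero, add_zero] at h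
    intro d hd
    rw [Finset.mem_range] at hd
    rw [ih d hd (by omega), zero_mul]

theorem coeff_act_of_X_pow_dvd (u : FesenkoGroup p r) {f : PowerSeries (ZMod p)} {m : ℕ}
    (hf : X ^ m ∣ f) : coeff m (act u f) = coeff m f := by
  rw [X_pow_dvd_iff] at hf
  rw [coeff_act, Finset.sum_eq_zero, add_zero]
  intro d hd
  rw [hf d (Finset.mem_range.mp hd), zero_mul]

theorem coeff_mul_of_X_pow_dvd {R : Type*} [CommRing R] (A : PowerSeries R) {g : PowerSeries R}
    {m : ℕ} (hg : X ^ m ∣ g) : coeff m (A * g) = constantCoeff A * coeff m g := by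
  obtain ⟨h, rfl⟩ := hg
  rw [mul_left_comm, coeff_X_pow_mul', coeff_X_pow_mul']
  simp

/-- Frobenius gives F_v^q ≡ 1 modulo x^{qm}. The constant term of g is fixed, and a term of degree d
≥ 1 changes only from degree qm + d on. -/
theorem X_pow_dvd_act_sub_of_dvd_reduced_sub_one {v : FesenkoGroup p r} {m : ℕ}
    (hv : X ^ m ∣ reduced v - 1) (g : PowerSeries (ZMod p)) :
    X ^ (p ^ r * m + 1) ∣ act v g - g := by
  rw [X_pow_dvd_iff]
  intro n hn
  rw [map_sub, coeff_act, add_sub_cancel_left]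
  refine Finset.sum_eq_zero fun d hd => ?_
  rw [Finset.mem_range] at hd
  have h1 : (X : PowerSeries (ZMod p)) ^ (m * p ^ r) ∣ reduced v ^ (p ^ r * d) - 1 := by
    have h2 := pow_dvd_pow_of_dvd hv (p ^ r)
    have : CharP (PowerSeries (ZMod p)) p := charP_of_injective_ringHom C_injective p
    rw [← pow_mul, sub_pow_char_pow, one_pow] at h2
    have h3 := sub_dvd_pow_sub_pow (reduced v ^ p ^ r) 1 d
    rw [one_pow, ← pow_mul] at h3
    exact h2.trans h3
  rcases Nat.eq_zero_or_pos d with rfl | hd0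
  · rw [mul_zero, pow_zero, coeff_one, if_neg (by omega), mul_zero]
  · have h2 := X_pow_dvd_iff.mp h1 (n - d) (by rw [mul_comm]; omega)
    rw [map_sub, coeff_one, if_neg (by omega), sub_zero] at h2
    rw [h2, mul_zero]

/-- The series whose coefficients vanish at all multiples of `p` below `L`. -/
def primitiveBelow (p L : ℕ) : Submodule (ZMod p) (PowerSeries (ZMod p)) where
  carrier := {f | ∀ j < L, p ∣ j → coeff j f = 0}
  add_mem' := fun hf hg j hj hp => by rw [map_add, hf j hj hp, hg j hj hp, add_zero]
  zero_mem' := fun _ _ _ => map_zero _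
  smul_mem' := fun c f hf j hj hp => by
    rw [map_smul, hf j hj hp, smul_zero]

theorem mem_primitiveBelow {L : ℕ} {f : PowerSeries (ZMod p)} :
    f ∈ primitiveBelow p L ↔ ∀ j < L, p ∣ j → coeff j f = 0 := Iff.rfl

omit [Fact p.Prime] in
theorem primitiveBelow_anti {L L' : ℕ} (h : L ≤ L') : primitiveBelow p L' ≤ primitiveBelow p L :=
  fun _ hf j hj => hf j (hj.trans_le h)

theorem mem_primitiveBelow_of_X_pow_dvd {L : ℕ} {f : PowerSeries (ZMod p)} (h : X ^ L ∣ f) :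
    f ∈ primitiveBelow p L := fun j hj _ => X_pow_dvd_iff.mp h j hj

/-- Degree d feeds degree n only if q ∣ n - d, so p ∣ n forces p ∣ d. Then d ≥ L, and F^{qd} is a
series in x^{pq}, so n ≥ L + pq. -/
theorem act_sub_mem_primitiveBelow (hr : 1 ≤ r) (u : FesenkoGroup p r) {L : ℕ}
    {f : PowerSeries (ZMod p)} (hf : f ∈ primitiveBelow p L) :
    act u f - f ∈ primitiveBelow p (L + p * p ^ r) := by
  intro n hn hpn
  rw [map_sub, coeff_act, add_sub_cancel_left]
  refine Finset.sum_eq_zero fun d hd => ?_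
  rw [Finset.mem_range] at hd
  by_cases hpd : p ∣ d
  · by_cases hdL : d < L
    · rw [hf d hdL hpd, zero_mul]
    · obtain ⟨e, rfl⟩ := hpd
      rw [← mul_assoc, ← pow_succ, coeff_pow_pow_pow_of_not_dvd (r + 1) e, mul_zero]
      rw [pow_succ']
      exact Nat.not_dvd_of_pos_of_lt (by omega) (by omega)
  · rw [coeff_reduced_pow_of_not_dvd, mul_zero]
    intro h
    have h2 : p ∣ n - d := (dvd_pow_self p (by omega)).trans h
    exact hpd ((Nat.dvd_sub_iff_right hd.le hpn).mp h2)

theorem act_mem_primitiveBelow (hr : 1 ≤ r) (u : FesenkoGroup p r) {L : ℕ}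
    {f : PowerSeries (ZMod p)} (hf : f ∈ primitiveBelow p L) :
    act u f ∈ primitiveBelow p L := by
  have h := Submodule.add_mem _
    (primitiveBelow_anti (Nat.le_add_right _ _) (act_sub_mem_primitiveBelow hr u hf)) hf
  rwa [sub_add_cancel] at h

theorem mem_primitiveBelow_of_act (hr : 1 ≤ r) (u : FesenkoGroup p r) {L : ℕ}
    {f : PowerSeries (ZMod p)} (hf : act u f ∈ primitiveBelow p L) :
    f ∈ primitiveBelow p L := by
  -- Bootstrap: if f is clean below M, the action alters it at multiples of p only from M + pq on,
  -- so cleanness of the image passes to degree M.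
  suffices h : ∀ M ≤ L, f ∈ primitiveBelow p M from h L le_rfl
  intro M
  induction M with
  | zero => intro _ j hj; omega
  | succ M ih =>
    intro hM
    have hpos : 0 < p * p ^ r :=
      Nat.mul_pos (Fact.out : p.Prime).pos (pow_pos (Fact.out : p.Prime).pos r)
    have h1 := primitiveBelow_anti (show M + 1 ≤ M + p * p ^ r by omega)
      (act_sub_mem_primitiveBelow hr u (ih (by omega)))
    have h2 := Submodule.sub_mem _ (primitiveBelow_anti hM hf) h1
    rwa [sub_sub_cancel] at h2

/-! ### Commutators -/

theorem X_pow_dvd_of_mul_reduced (u : FesenkoGroup p r) {g : PowerSeries (ZMod p)} {m : ℕ}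
    (h : X ^ m ∣ reduced u * g) : X ^ m ∣ g := by
  have hu : IsUnit (reduced u) := by
    rw [isUnit_iff_constantCoeff, constantCoeff_reduced]
    exact isUnit_one
  exact (hu.dvd_mul_left).mp h

/-- Apply the product formula to ⁅v, u⁆ · (u v) = v u. The difference is exactly -F_v times the
change that v makes in F_u, which is small. -/
theorem X_pow_dvd_commutator_sub {v : FesenkoGroup p r} {m : ℕ} (hv : X ^ m ∣ reduced v - 1)
    (u : FesenkoGroup p r) :
    X ^ (p ^ r * m + 1) ∣ reduced (u * v) * act (u * v) (reduced ⁅v, u⁆ - 1) -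
      reduced u * (act u (reduced v - 1) - (reduced v - 1)) := by
  have h1 : reduced (u * v) * act (u * v) (reduced ⁅v, u⁆) = reduced (v * u) := by
    rw [← reduced_mul]
    congr 1
    rw [commutatorElement_def]
    group
  have h2 : reduced (u * v) * act (u * v) (reduced ⁅v, u⁆ - 1) -
      reduced u * (act u (reduced v - 1) - (reduced v - 1)) =
      -(reduced v * (act v (reduced u) - reduced u)) := by
    rw [map_sub, mul_sub, h1, map_one, mul_one, reduced_mul, reduced_mul, map_sub, map_one]
    ring
  rw [h2, dvd_neg]
  exact (X_pow_dvd_act_sub_of_dvd_reduced_sub_one hv _).mul_left _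

theorem two_le_prime_pow (p : ℕ) [Fact p.Prime] {r : ℕ} (hr : 1 ≤ r) : 2 ≤ p ^ r :=
  (Fact.out : p.Prime).two_le.trans (Nat.le_self_pow (by omega) p)

theorem X_pow_dvd_act_commutator (hr : 1 ≤ r) {v : FesenkoGroup p r} {m : ℕ} (hm : 1 ≤ m)
    (hv : X ^ m ∣ reduced v - 1) (u : FesenkoGroup p r) :
    X ^ (m + p ^ r) ∣ act (u * v) (reduced ⁅v, u⁆ - 1) := by
  have hq := two_le_prime_pow p hr
  have hle : m + p ^ r ≤ p ^ r * m + 1 := by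
    obtain ⟨m, rfl⟩ := Nat.exists_eq_add_of_le hm
    nlinarith
  have h := dvd_add ((pow_dvd_pow X hle).trans (X_pow_dvd_commutator_sub hv u))
    ((X_pow_dvd_act_sub u hv).mul_left (reduced u))
  rw [sub_add_cancel] at h
  exact X_pow_dvd_of_mul_reduced _ h

theorem X_pow_dvd_commutator (hr : 1 ≤ r) {v : FesenkoGroup p r} {m : ℕ} (hm : 1 ≤ m)
    (hv : X ^ m ∣ reduced v - 1) (u : FesenkoGroup p r) :
    X ^ (m + p ^ r) ∣ reduced ⁅v, u⁆ - 1 :=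
  X_pow_dvd_of_act _ (X_pow_dvd_act_commutator hr hm hv u)

theorem X_pow_dvd_reduced_mul_sub {v : FesenkoGroup p r} {m : ℕ} (hv : X ^ m ∣ reduced v - 1)
    (u : FesenkoGroup p r) : X ^ m ∣ reduced (u * v) - reduced u := by
  have h : reduced (u * v) - reduced u =
      (reduced v - 1) * act v (reduced u) + (act v (reduced u) - reduced u) := by
    rw [reduced_mul]
    ring
  rw [h]
  refine dvd_add (hv.mul_right _) ((pow_dvd_pow X ?_).trans
    (X_pow_dvd_act_sub_of_dvd_reduced_sub_one hv _))
  have := Nat.le_mul_of_pos_left m (pow_pos (Fact.out : p.Prime).pos r)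
  omega

/-- Modulo x^{2m} the factors F_{uv} and F_u cancel: they agree modulo x^m and multiply a series
divisible by x^m. What remains is linear in F_v - 1. -/
theorem X_pow_two_mul_dvd_act_commutator_sub (hr : 1 ≤ r) {v : FesenkoGroup p r} {m : ℕ}
    (hm : 1 ≤ m) (hv : X ^ m ∣ reduced v - 1) (u : FesenkoGroup p r) :
    X ^ (2 * m) ∣ act (u * v) (reduced ⁅v, u⁆ - 1) -
      (act u (reduced v - 1) - (reduced v - 1)) := by
  have hq := two_le_prime_pow p hr
  have h1 := (pow_dvd_pow X (show 2 * m ≤ p ^ r * m + 1 by nlinarith)).trans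
    (X_pow_dvd_commutator_sub hv u)
  have h2 := mul_dvd_mul (X_pow_dvd_reduced_mul_sub hv u)
    ((pow_dvd_pow X (Nat.le_add_right _ _)).trans (X_pow_dvd_act_commutator hr hm hv u))
  rw [← pow_add, ← two_mul] at h2
  apply X_pow_dvd_of_mul_reduced u
  convert dvd_sub h1 h2 using 1
  ring

/-! ### Congruence subgroups -/

/-- The elements whose reduced series is `1` modulo `x ^ m` and in which no exponent divisible by
`p` and smaller than `min L (2 * m)` occurs. -/
noncomputable def primitiveCongruence (hr : 1 ≤ r) (m L : ℕ) : Subgroup (FesenkoGroup p r) where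
  carrier := {u | X ^ m ∣ reduced u - 1 ∧ reduced u - 1 ∈ primitiveBelow p (min L (2 * m))}
  one_mem' := by
    simp [reduced_one]
  mul_mem' := by
    rintro u v ⟨hu, hu'⟩ ⟨hv, hv'⟩
    have h : reduced (u * v) - 1 = (reduced v - 1) + act v (reduced u - 1) +
        (reduced v - 1) * act v (reduced u - 1) := by
      rw [reduced_mul, map_sub, map_one]
      ring
    -- The quadratic term is divisible by x^{2m} but otherwise uncontrolled; hence the cap 2m in the
    -- definition.
    have hd := mul_dvd_mul hv (X_pow_dvd_act v hu)
    rw [← pow_add, ← two_mul] at hd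
    refine ⟨?_, ?_⟩
    · rw [h]
      exact dvd_add (dvd_add hv (X_pow_dvd_act v hu)) (hv.mul_right _)
    · rw [h]
      exact Submodule.add_mem _ (Submodule.add_mem _ hv' (act_mem_primitiveBelow hr v hu'))
        (primitiveBelow_anti (min_le_right _ _) (mem_primitiveBelow_of_X_pow_dvd hd))
  inv_mem' := by
    rintro u ⟨hu, hu'⟩
    have h : act u (reduced u⁻¹ - 1) = -(reduced u - 1) -
        (reduced u - 1) * act u (reduced u⁻¹ - 1) := by
      have h1 : reduced u * act u (reduced u⁻¹) = 1 := by
        rw [← reduced_mul, inv_mul_cancel, reduced_one]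
      rw [map_sub, map_one]
      linear_combination h1
    have h1 : X ^ m ∣ act u (reduced u⁻¹ - 1) := by
      rw [h]
      exact dvd_sub (dvd_neg.mpr hu) (hu.mul_right _)
    have hd := mul_dvd_mul hu h1
    rw [← pow_add, ← two_mul] at hd
    refine ⟨X_pow_dvd_of_act u h1, mem_primitiveBelow_of_act hr u ?_⟩
    rw [h]
    exact Submodule.sub_mem _ (Submodule.neg_mem _ hu')
      (primitiveBelow_anti (min_le_right _ _) (mem_primitiveBelow_of_X_pow_dvd hd))

theorem mem_primitiveCongruence (hr : 1 ≤ r) {m L : ℕ} {u : FesenkoGroup p r} :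
    u ∈ primitiveCongruence hr m L ↔
      X ^ m ∣ reduced u - 1 ∧ reduced u - 1 ∈ primitiveBelow p (min L (2 * m)) := Iff.rfl

/-- For L = m the condition on multiples of p is automatic, which leaves the full congruence
subgroup. -/
theorem mem_primitiveCongruence_self (hr : 1 ≤ r) {m : ℕ} {u : FesenkoGroup p r} :
    u ∈ primitiveCongruence hr m m ↔ X ^ m ∣ reduced u - 1 :=
  ⟨And.left, fun h => ⟨h, primitiveBelow_anti (min_le_left _ _)
    (mem_primitiveBelow_of_X_pow_dvd h)⟩⟩

theorem commutator_mem_primitiveCongruence (hr : 1 ≤ r) {m L : ℕ} (hm : 1 ≤ m)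
    {v : FesenkoGroup p r} (hv : v ∈ primitiveCongruence hr m L) (u : FesenkoGroup p r) :
    ⁅v, u⁆ ∈ primitiveCongruence hr m (L + p * p ^ r) := by
  refine ⟨(pow_dvd_pow X (Nat.le_add_right _ _)).trans (X_pow_dvd_commutator hr hm hv.1 u),
    mem_primitiveBelow_of_act hr (u * v) ?_⟩
  have h1 := mem_primitiveBelow_of_X_pow_dvd (X_pow_two_mul_dvd_act_commutator_sub hr hm hv.1 u)
  have h2 := act_sub_mem_primitiveBelow hr u hv.2
  have h3 := Submodule.add_mem _ (primitiveBelow_anti (min_le_right (L + p * p ^ r) _) h1)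
    (primitiveBelow_anti (show min (L + p * p ^ r) (2 * m) ≤ _ by omega) h2)
  rwa [sub_add_cancel] at h3

theorem isClosed_primitiveCongruence (hr : 1 ≤ r) (m L : ℕ) :
    IsClosed ((primitiveCongruence hr m L : Subgroup (FesenkoGroup p r)) : Set (FesenkoGroup p r)) := by
  have hc (j : ℕ) : Continuous fun u : FesenkoGroup p r => coeff j (reduced u - 1) := by
    simp only [map_sub, reduced, coeff_mk]
    exact ((WithPiTopology.continuous_coeff (ZMod p) _).comp
      (Nottingham.continuous_val.comp continuous_subtype_val)).sub continuous_const
  have h : ((primitiveCongruence hr m L : Subgroup (FesenkoGroup p r)) : Set (FesenkoGroup p r)) =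
      (⋂ j : ℕ, ⋂ _ : j < m, {u | coeff j (reduced u - 1) = 0}) ∩
      ⋂ j : ℕ, ⋂ _ : j < min L (2 * m), ⋂ _ : p ∣ j, {u | coeff j (reduced u - 1) = 0} := by
    ext u
    rw [SetLike.mem_coe, mem_primitiveCongruence, X_pow_dvd_iff, mem_primitiveBelow]
    simp only [Set.mem_inter_iff, Set.mem_iInter, Set.mem_ofPred_eq]
  rw [h]
  exact (isClosed_iInter fun j => isClosed_iInter fun _ => isClosed_eq (hc j) continuous_const).inter
    (isClosed_iInter fun j => isClosed_iInter fun _ => isClosed_iInter fun _ =>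
      isClosed_eq (hc j) continuous_const)

theorem normal_primitiveCongruence_self (hr : 1 ≤ r) {m : ℕ} (hm : 1 ≤ m) :
    (primitiveCongruence hr m m : Subgroup (FesenkoGroup p r)).Normal where
  conj_mem v hv u := by
    have h1 : ⁅v, u⁆ ∈ primitiveCongruence hr m m :=
      (mem_primitiveCongruence_self hr).mpr ((pow_dvd_pow X (Nat.le_add_right _ _)).trans
        (X_pow_dvd_commutator hr hm hv.1 u))
    have h2 := mul_mem (inv_mem h1) hv
    rwa [commutatorElement_inv, commutatorElement_def, inv_mul_cancel_right] at h2

/-! ### The lower central series -/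

theorem lowerCentralSeries_le_congruence (hr : 1 ≤ r) (n : ℕ) :
    (⊤ : Subgroup (FesenkoGroup p r)).lowerCentralSeries n ≤
      primitiveCongruence hr (n * p ^ r + 1) (n * p ^ r + 1) := by
  induction n with
  | zero =>
    intro u _
    rw [mem_primitiveCongruence_self, zero_mul, zero_add, pow_one, X_dvd_iff, map_sub,
      constantCoeff_reduced, map_one, sub_self]
  | succ n ih =>
    rw [Subgroup.lowerCentralSeries_succ, Subgroup.commutator_le]
    intro v hv u _
    rw [mem_primitiveCongruence_self,
      show (n + 1) * p ^ r + 1 = n * p ^ r + 1 + p ^ r by ring]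
    exact X_pow_dvd_commutator hr (by omega) (ih hv).1 u

/-- The first n commutators fix the order and with it the cap; the other k serve only to clear
multiples of p. -/
theorem lowerCentralSeries_le_primitiveCongruence (hr : 1 ≤ r) (n k : ℕ) :
    (⊤ : Subgroup (FesenkoGroup p r)).lowerCentralSeries (n + k) ≤
      primitiveCongruence hr (n * p ^ r + 1) (n * p ^ r + 1 + k * (p * p ^ r)) := by
  induction k with
  | zero => simpa using lowerCentralSeries_le_congruence hr n
  | succ k ih =>
    rw [← add_assoc, Subgroup.lowerCentralSeries_succ, Subgroup.commutator_le]
    intro v hv u _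
    rw [show n * p ^ r + 1 + (k + 1) * (p * p ^ r) =
      n * p ^ r + 1 + k * (p * p ^ r) + p * p ^ r by ring]
    exact commutator_mem_primitiveCongruence hr (by omega) (ih hv) u

theorem proGammaSucc_le_primitiveCongruence (hr : 1 ≤ r) (n k : ℕ) :
    proGammaSucc (FesenkoGroup p r) (n + k) ≤
      primitiveCongruence hr (n * p ^ r + 1) (n * p ^ r + 1 + k * (p * p ^ r)) :=
  Subgroup.topologicalClosure_minimal _ (lowerCentralSeries_le_primitiveCongruence hr n k)
    (isClosed_primitiveCongruence hr _ _)

/-! ### Elements of prescribed order in the lower central series. -/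

theorem coeff_act_sub_of_reduced_eq {u : FesenkoGroup p r} (hu : reduced u = 1 + X)
    {f : PowerSeries (ZMod p)} {m : ℕ} (hf : X ^ m ∣ f) :
    coeff (m + p ^ r) (act u f - f) = m * coeff m f := by
  have hq := pow_pos (Fact.out : p.Prime).pos r
  rw [X_pow_dvd_iff] at hf
  rw [map_sub, coeff_act, add_sub_cancel_left, Finset.sum_eq_single m]
  · have : CharP (PowerSeries (ZMod p)) p := charP_of_injective_ringHom C_injective p
    -- (1 + x)^{qm} = (1 + x^q)^m, whose coefficient at x^q is m.
    have h : coeff (p ^ r) ((1 + X : PowerSeries (ZMod p)) ^ (p ^ r * m)) = m := by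
      rw [pow_mul, add_pow_char_pow, one_pow, ← expand_X _ (prime_pow_ne_zero p r),
        ← map_one (expand (p ^ r) (prime_pow_ne_zero p r)), ← map_add, ← map_pow]
      rw [coeff_expand, if_pos dvd_rfl, Nat.div_self hq, add_comm]
      have h2 := Polynomial.coeff_X_add_one_pow (ZMod p) m 1
      rw [← Polynomial.coeff_coe] at h2
      simpa using h2
    rw [Nat.add_sub_cancel_left, hu, h, mul_comm]
  · intro d hd hdm
    rw [Finset.mem_range] at hd
    rcases lt_or_gt_of_ne hdm with h | h
    · rw [hf d h, zero_mul]
    · rw [coeff_reduced_pow_of_not_dvd, mul_zero]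
      exact Nat.not_dvd_of_pos_of_lt (by omega) (by omega)
  · intro h
    exact absurd (Finset.mem_range.mpr (by omega)) h

theorem coeff_commutator_ne_zero (hr : 1 ≤ r) {u v : FesenkoGroup p r} {m : ℕ} (hm : 2 ≤ m)
    (hpm : ¬ p ∣ m) (hu : reduced u = 1 + X) (hv : X ^ m ∣ reduced v - 1)
    (hvm : coeff m (reduced v - 1) ≠ 0) :
    coeff (m + p ^ r) (reduced ⁅v, u⁆ - 1) ≠ 0 := by
  have hq := two_le_prime_pow p hr
  -- The leading term must precede the error of order qm + 1; this fails for m = 1.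
  have hlt : m + p ^ r < p ^ r * m + 1 := by
    obtain ⟨m, rfl⟩ := Nat.exists_eq_add_of_le hm
    nlinarith
  have h := X_pow_dvd_iff.mp (X_pow_dvd_commutator_sub hv u) _ hlt
  have hw := X_pow_dvd_commutator hr (by omega) hv u
  rw [map_sub, coeff_mul_of_X_pow_dvd _ (X_pow_dvd_act _ hw), coeff_act_of_X_pow_dvd _ hw,
    coeff_mul_of_X_pow_dvd _ (X_pow_dvd_act_sub u hv), coeff_act_sub_of_reduced_eq hu hv,
    constantCoeff_reduced, constantCoeff_reduced, one_mul, one_mul, sub_eq_zero] at h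
  rw [h]
  exact mul_ne_zero (mt (ZMod.natCast_eq_zero_iff m p).mp hpm) hvm

theorem exists_mem_lowerCentralSeries (hr : 1 ≤ r) {j : ℕ} (hj : 2 ≤ j) (hpj : ¬ p ∣ j) (n : ℕ) :
    ∃ v ∈ (⊤ : Subgroup (FesenkoGroup p r)).lowerCentralSeries n,
      X ^ (j + n * p ^ r) ∣ reduced v - 1 ∧ coeff (j + n * p ^ r) (reduced v - 1) ≠ 0 := by
  induction n with
  | zero =>
    refine ⟨ofReduced r (1 + X ^ j) (by simp [show j ≠ 0 by omega]), trivial, ?_⟩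
    simp [reduced_ofReduced, coeff_X_pow]
  | succ n ih =>
    obtain ⟨v, hv, h1, h2⟩ := ih
    have hu := reduced_ofReduced (r := r) (1 + X : PowerSeries (ZMod p)) (by simp)
    refine ⟨⁅v, ofReduced r (1 + X) (by simp)⁆, ?_, ?_, ?_⟩
    · rw [Subgroup.lowerCentralSeries_succ]
      exact Subgroup.commutator_mem_commutator hv trivial
    · rw [add_mul, one_mul, ← add_assoc]
      exact X_pow_dvd_commutator hr (by omega) h1 _
    · rw [add_mul, one_mul, ← add_assoc]
      refine coeff_commutator_ne_zero hr (by omega) ?_ hu h1 h2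
      rwa [Nat.dvd_add_left ((dvd_pow_self p (by omega)).mul_left n)]

/-! ### Obliquity -/

theorem not_congruence_le_proGammaSucc (hr : 1 ≤ r) (k : ℕ) (hk : 1 ≤ k) :
    ¬ primitiveCongruence hr (4 * k * p ^ r) (4 * k * p ^ r) ≤
      proGammaSucc (FesenkoGroup p r) (2 * k + k) := by
  intro hle
  have hp := (Fact.out : p.Prime).two_le
  have hq := two_le_prime_pow p hr
  have hc : constantCoeff (1 + X ^ (4 * k * p ^ r) : PowerSeries (ZMod p)) = 1 := by
    have : 4 * k * p ^ r ≠ 0 := by positivity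
    rw [map_add, map_pow, constantCoeff_X, zero_pow this, map_one, add_zero]
  have hmem := hle ((mem_primitiveCongruence_self hr).mpr
    (show X ^ (4 * k * p ^ r) ∣ reduced (ofReduced r (1 + X ^ (4 * k * p ^ r)) hc) - 1 by
      rw [reduced_ofReduced, add_sub_cancel_left]))
  -- The exponent 4kq is a multiple of p just below the cap 2(2kq + 1).
  have h := (proGammaSucc_le_primitiveCongruence hr (2 * k) k hmem).2 (4 * k * p ^ r) ?_
    ((dvd_pow_self p (by omega)).mul_left _)
  · rw [reduced_ofReduced, add_sub_cancel_left, coeff_X_pow, if_pos rfl] at h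
    exact one_ne_zero h
  · have h1 : 2 * (k * p ^ r) ≤ k * (p * p ^ r) := by
      calc 2 * (k * p ^ r) ≤ p * (k * p ^ r) := Nat.mul_le_mul_right _ hp
        _ = k * (p * p ^ r) := by ring
    rw [lt_min_iff]
    constructor <;> nlinarith

theorem le_relIndex_proMu (hr : 1 ≤ r) (k : ℕ)
    (h0 : (proMu (FesenkoGroup p r) (2 * (k + 1) + (k + 1))).relIndex
      (proGammaSucc (FesenkoGroup p r) (2 * (k + 1) + (k + 1))) ≠ 0) :
    k ≤ (proMu (FesenkoGroup p r) (2 * (k + 1) + (k + 1))).relIndex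
      (proGammaSucc (FesenkoGroup p r) (2 * (k + 1) + (k + 1))) := by
  set n := 2 * (k + 1) + (k + 1) with hn
  set γ := proGammaSucc (FesenkoGroup p r) n with hγ
  set μ := proMu (FesenkoGroup p r) n with hμ
  have hp := (Fact.out : p.Prime).two_le
  have hq := two_le_prime_pow p hr
  have hpq : p ≤ p ^ r := Nat.le_self_pow (by omega) p
  have hμN : μ ≤ primitiveCongruence hr (4 * (k + 1) * p ^ r) (4 * (k + 1) * p ^ r) :=
    inf_le_right.trans (sInf_le ⟨normal_primitiveCongruence_self hr (by nlinarith),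
      isClosed_primitiveCongruence hr _ _, not_congruence_le_proGammaSucc hr (k + 1) (by omega)⟩)
  -- The orders p(i + 1) + 1 + nq increase with i, and p(i + 1) + 1 is prime to p and at least 2.
  have hex (i : Fin k) := exists_mem_lowerCentralSeries (p := p) hr
    (j := p * (i + 1) + 1) (by nlinarith)
    (by
      rw [Nat.dvd_add_right (dvd_mul_right _ _), Nat.dvd_one]
      omega) n
  choose w hw hd hc using hex
  have hγw (i : Fin k) : w i ∈ γ := Subgroup.le_topologicalClosure _ (hw i)
  have hne (i j : Fin k) (hij : i < j) : ¬ (w j)⁻¹ * w i ∈ μ := by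
    intro hmem
    have hsucc : p * ((i : ℕ) + 1) + 1 + n * p ^ r + 1 ≤ p * ((j : ℕ) + 1) + 1 + n * p ^ r := by
      have : (i : ℕ) + 1 ≤ j := hij
      nlinarith
    -- Here n = 3(k + 1), so a window of length (k + 1)q remains above nq; it contains all k orders
    -- because p ≤ q.
    have hbound : p * ((j : ℕ) + 1) + 1 + n * p ^ r ≤ 4 * (k + 1) * p ^ r := by
      have h1 : p * ((j : ℕ) + 1) + 1 ≤ p * (k + 1) := by
        have := j.2
        nlinarith
      have h2 : p * (k + 1) ≤ p ^ r * (k + 1) := Nat.mul_le_mul_right _ hpq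
      have h3 : n * p ^ r = 3 * (p ^ r * (k + 1)) := by rw [hn]; ring
      have h4 : 4 * (k + 1) * p ^ r = 4 * (p ^ r * (k + 1)) := by ring
      omega
    -- K is the exact order of `w i`. If `w i` and `w j` were congruent modulo μ, then `w i` would
    -- have order at least K + 1.
    set K := p * ((i : ℕ) + 1) + 1 + n * p ^ r with hK
    have hj : w j ∈ primitiveCongruence hr (K + 1) (K + 1) :=
      (mem_primitiveCongruence_self hr).mpr ((pow_dvd_pow X hsucc).trans (hd j))
    have hN : (w j)⁻¹ * w i ∈ primitiveCongruence hr (K + 1) (K + 1) :=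
      (mem_primitiveCongruence_self hr).mpr
        ((pow_dvd_pow X (hsucc.trans hbound)).trans (hμN hmem).1)
    have hi := mul_mem hj hN
    rw [mul_inv_cancel_left] at hi
    exact hc i (X_pow_dvd_iff.mp hi.1 K (Nat.lt_succ_self K))
  have hfin : Finite (γ ⧸ μ.subgroupOf γ) := Nat.finite_of_card_ne_zero h0
  let φ : Fin k → γ ⧸ μ.subgroupOf γ := fun i => QuotientGroup.mk (⟨w i, hγw i⟩ : γ)
  have hφ : Function.Injective φ := by
    intro i j hij
    have h1 : (w i)⁻¹ * w j ∈ μ :=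
      Subgroup.mem_subgroupOf.mp (QuotientGroup.eq.mp hij)
    have h2 : (w j)⁻¹ * w i ∈ μ :=
      Subgroup.mem_subgroupOf.mp (QuotientGroup.eq.mp hij.symm)
    rcases lt_trichotomy i j with h | h | h
    · exact absurd h2 (hne i j h)
    · exact h
    · exact absurd h1 (hne j i h)
  have h := Nat.card_le_card_of_injective φ hφ
  rwa [Nat.card_fin] at h

end FesenkoGroup

theorem proposition4p1 (p : ℕ) [Fact p.Prime] (r : ℕ) (hr : 1 ≤ r) :
    obliquity (FesenkoGroup p r) p = ⊤ := by
  rw [EReal.eq_top_iff_forall_lt]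
  intro y
  have hp : (1 : ℝ) < p := by exact_mod_cast (Fact.out : p.Prime).one_lt
  obtain ⟨k, hk⟩ := exists_nat_gt ((p : ℝ) ^ y)
  refine lt_of_lt_of_le ?_ (le_iSup _ (2 * (k + 1) + (k + 1)))
  rw [logRelIndex]
  -- Relative index 0 stands for an infinite index, where the supremum is reached at once.
  split_ifs with h0
  · exact EReal.coe_lt_top y
  · rw [EReal.coe_lt_coe_iff,
      Real.lt_logb_iff_rpow_lt hp (by exact_mod_cast Nat.pos_of_ne_zero h0)]
    exact hk.trans_le (by exact_mod_cast FesenkoGroup.le_relIndex_proMu hr k h0)
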